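/- Setting. For each $n$ let $(\Omega_n,\mu_n)$ be a measure space of microstates (informally $d\mu_n=d\omega$), $H_n:\Omega_n\to\mathbb R$ a measurable Hamiltonian, $h_n=H_n/n$ the mean energy, and $m_n:\Omega_n\to X$ a measurable macrostate with values in a topological space $X$ with its Borel $\sigma$-algebra. Assume that the microcanonical entropy $s:\mathbb R\to[-\infty,+\infty]$, $$s(u)=\lim_{r\to0^+}\lim_{n\to\infty}\tfrac1n\ln\mu_n\{|h_n-u|\le r\},$$ exists for every $u$ (the limits $r\to0^+$ of the lower and of the upper limit in $n$ exist and agree), and that the mean energy is asymptotically a function of the macrostate: there is a continuous $\tilde h:X\to\mathbb R$ with $\sup_{\omega\in\Omega_n}|h_n(\omega)-\tilde h(m_n(\omega))|\to0$ as $n\to\infty$. Let $g:\mathbb R\to\mathbb R$ be any continuous function, put $s_g=s-g$, and let $u$ be a mean energy at which $s(u)$ is finite. The microcanonical ensemble $P_n^{u,r}$ is $\mu_n$ conditioned on $\{|h_n-u|\le r\}$; its set of equilibrium macrostates $\mathcal E^u$ consists of all $x\in X$ such that for every open $U\ni x$, $\lim_{r\to0^+}\liminf_{n\to\infty}\frac1n\ln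 P_n^{u,r}(m_n\in U)=0$. The generalized canonical ensemble with function $g$ and parameter $\alpha\in\mathbb R$ is $P_{n,g,\alpha}(d\omega)=Z_{g,n}(\alpha)^{-1}e^{-n\alpha h_n-ng(h_n)}\,d\mu_n$, where $Z_{g,n}(\alpha)=\int_{\Omega_n} e^{-n\alpha h_n-ng(h_n)}\,d\mu_n$ (read as the zero measure if $Z_{g,n}(\alpha)=\infty$); its set of equilibrium macrostates $\mathcal E_{g,\alpha}$ consists of all $x\in X$ such that $\liminf_{n\to\infty}\frac1n\ln P_{n,g,\alpha}(m_n\in U)=0$ for every open $U\ni x$. Let $A_g$ be the interior of the set of $\alpha\in\mathbb R$ with $\limsup_n\frac1n\ln Z_{g,n}(\alpha)<\infty$ (for instance $A_g=\mathbb R$ if the $h_n$ are uniformly bounded and $s<+\infty$). The function $s_g$ admits a supporting line at $u$ with slope $\alpha\in\mathbb R$ if $s_g(v)\le s_g(u)+\alpha(v-u)$ for all $v$, and a strict one if $s_g(v)<s_g(u)+\alpha(v-u)$ for all $v\ne u$. Write $f^*(\beta)=\inf_v\{\beta v-f(v)\}$ for the Legendre--Fenchel transform, and $s_g^{**}=(s_g^*)^*$.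 Theorem. (a) If $s_g$ admits a strict supporting line at $u$ with slope in $A_g$, then $\mathcal E^u=\mathcal E_{g,\alpha}$ for some $\alpha\in A_g$, which is the slope of a strict supporting line of $s_g$ at $u$ and equals $s_g'(u)$ if $s_g$ is finite near $u$ and differentiable at $u$. (b) If $s_g$ admits no supporting line at $u$, then $\mathcal E^u\cap\mathcal E_{g,\alpha}=\emptyset$ for all $\alpha\in\mathbb R$. The same conclusion holds if $s_g(u)\ne s_g^{**}(u)$. Moreover these two conditions are equivalent if $u$ is in the relative interior of the convex hull of $\{v: s(v)>-\infty\}$. -/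

import Mathlib

open Filter Topology MeasureTheory
open scoped ENNReal

noncomputable section

/-- A sequence of `n`-body systems: microstate spaces `Ω n` with reference measures `μ n` (written
`dω` informally), Hamiltonians `H n`, and a macrostate (order parameter) `m n` with values in `X`. -/
structure ManyBodySystem (X : Type*) [MeasurableSpace X] where
  /-- microstate spaces -/
  Ω : ℕ → Type*
  /-- measurable structure of the microstate spaces -/
  [measΩ : ∀ n, MeasurableSpace (Ω n)]
  /-- reference measures -/
  μ : ∀ n, Measure (Ω n)
  /-- Hamiltonians -/
  H : ∀ n, Ω n → ℝ
  measurable_H : ∀ n, Measurable (H n)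
  /-- the macrostate -/
  m : ∀ n, Ω n → X
  measurable_m : ∀ n, Measurable (m n)

attribute [instance] ManyBodySystem.measΩ

namespace ManyBodySystem

variable {X : Type*} [MeasurableSpace X] (S : ManyBodySystem X)

/-- The mean energy `h = H / n`. -/
def h (n : ℕ) (ω : S.Ω n) : ℝ := S.H n ω / n

/-- The energy shell of half-width `r` about the mean energy `u`. -/
def shell (u r : ℝ) (n : ℕ) : Set (S.Ω n) := {ω | |S.h n ω - u| ≤ r}

/-- `s` is the microcanonical entropy: `s u = lim (1/n) ln ρ_n(u)`, where the density of states
`ρ_n(u)` is read through thin energy shells (first `n → ∞`, then the width tends to `0`).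
The value `⊥ = -∞` means that `u` is not an accessible mean energy. -/
def IsMicrocanonicalEntropy (s : ℝ → EReal) : Prop :=
  ∀ u : ℝ,
    Tendsto (fun r : ℝ => ExpGrowth.expGrowthInf fun n => S.μ n (S.shell u r n))
      (𝓝[>] 0) (𝓝 (s u)) ∧
    Tendsto (fun r : ℝ => ExpGrowth.expGrowthSup fun n => S.μ n (S.shell u r n))
      (𝓝[>] 0) (𝓝 (s u))

/-- Asymptotically, the mean energy is a continuous function of the macrostate. -/
def HasEnergyRepresentation [TopologicalSpace X] : Prop :=
  ∃ hm : X → ℝ, Continuous hm ∧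
    ∀ ε : ℝ, 0 < ε → ∀ᶠ n in atTop, ∀ ω : S.Ω n, |S.h n ω - hm (S.m n ω)| ≤ ε

/-- The microcanonical ensemble: the reference measure conditioned on an energy shell. -/
def microcanonical (u r : ℝ) (n : ℕ) : Measure (S.Ω n) :=
  ProbabilityTheory.cond (S.μ n) (S.shell u r n)

/-- The weight `exp (-n α h(ω) - n g(h(ω)))`. -/
def weight (g : ℝ → ℝ) (α : ℝ) (n : ℕ) (ω : S.Ω n) : ℝ≥0∞ :=
  ENNReal.ofReal (Real.exp (-(n * α * S.h n ω) - n * g (S.h n ω)))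

/-- The generalized partition function `Z_{g,n}(α)`. -/
def partitionFunction (g : ℝ → ℝ) (α : ℝ) (n : ℕ) : ℝ≥0∞ :=
  ∫⁻ ω, S.weight g α n ω ∂(S.μ n)

/-- The generalized canonical ensemble, with density `exp (-n α h - n g(h)) / Z_{g,n}(α)`.
(It is the zero measure when the partition function is infinite.) -/
def generalizedCanonical (g : ℝ → ℝ) (α : ℝ) (n : ℕ) : Measure (S.Ω n) :=
  (S.partitionFunction g α n)⁻¹ • (S.μ n).withDensity (S.weight g α n)

/-- The interior of the set of parameters `α` at which the generalized free energy
`φ_g(α) = lim -(1/n) ln Z_{g,n}(α)` is not `-∞`. It is all of `ℝ` for instance when the mean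
energies are uniformly bounded and the entropy is nowhere `+∞`. -/
def admissibleParams (g : ℝ → ℝ) : Set ℝ :=
  interior {α | ExpGrowth.expGrowthSup (S.partitionFunction g α) < ⊤}

/-- Microcanonical equilibrium macrostates at mean energy `u`: the values `x` all of whose
neighbourhoods have probabilities that are not exponentially small, i.e. the zeros of the
(local) rate function of the macrostate. -/
def microEquilibrium [TopologicalSpace X] (u : ℝ) : Set X :=
  {x | ∀ U : Set X, IsOpen U → x ∈ U →
    Tendsto (fun r : ℝ => ExpGrowth.expGrowthInf fun n =>
      S.microcanonical u r n (S.m n ⁻¹' U)) (𝓝[>] 0) (𝓝 0)}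

/-- Equilibrium macrostates of the generalized canonical ensemble, in the same sense. -/
def canonEquilibrium [TopologicalSpace X] (g : ℝ → ℝ) (α : ℝ) : Set X :=
  {x | ∀ U : Set X, IsOpen U → x ∈ U →
    ExpGrowth.expGrowthInf (fun n => S.generalizedCanonical g α n (S.m n ⁻¹' U)) = 0}

end ManyBodySystem

/-- The line of slope `α` through `(u, f u)` lies above the graph of `f`. -/
def IsSupportingSlope (f : ℝ → EReal) (u α : ℝ) : Prop :=
  ∀ v : ℝ, f v ≤ f u + ((α * (v - u) : ℝ) : EReal)

/-- The line of slope `α` through `(u, f u)` lies strictly above the graph of `f` off `u`. -/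
def IsStrictSupportingSlope (f : ℝ → EReal) (u α : ℝ) : Prop :=
  ∀ v : ℝ, v ≠ u → f v < f u + ((α * (v - u) : ℝ) : EReal)

/-- The Legendre-Fenchel transform `f^*(β) = inf_v (β v - f v)`. -/
def lfTransform (f : ℝ → EReal) (β : ℝ) : EReal :=
  ⨅ v : ℝ, ((β * v : ℝ) : EReal) - f v

/-- The extended-real function `f` is finite near `u` and has derivative `d` at `u`. -/
def HasFiniteDerivAt (f : ℝ → EReal) (d u : ℝ) : Prop :=
  (∀ᶠ v in 𝓝 u, f v ≠ ⊥ ∧ f v ≠ ⊤) ∧ HasDerivAt (fun v => (f v).toReal) d u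

/-- The modified entropy `s_g = s - g`. -/
def modifiedEntropy (s : ℝ → EReal) (g : ℝ → ℝ) (u : ℝ) : EReal := s u - (g u : EReal)

end

/-! The canonical weight depends on a microstate only through its mean energy, and continuously, so
inside a thin shell about `v` it equals `exp (-n (α v + g v))` up to a small exponential error
(`exists_shell_growth`). Hence `Z` grows at rate at least `s v - α v - g v` for every `v`, and a
supporting line of slope `α` at `u` says that this expression is maximal at `u`, with value `a = s u
- α u - g u`.

(a) If the line is strict, compactness and an exponential Markov bound for the tails (this is where
`α` must be admissible) make the weight outside any shell about `u` grow at a rate below `a`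
(`expGrowthSup_compl_shell_lt`). So `Z` has rate exactly `a`, only the shell matters, and there the
two ensembles differ by a constant rate: the equilibrium conditions coincide.

(b) A microcanonical equilibrium `x` has energy `u`, so a small neighbourhood of `x` lies in a thin
shell about `u`, whose weight has rate at most `a + ε`. If `x` is also a canonical equilibrium, that
neighbourhood carries the full rate of `Z`, so `Z` has rate at most `a`, and the lower bound on `Z`
is then a supporting line (`isSupportingSlope_of_mem_inter`). The statements on `s_g^{**}` are
one-dimensional convex analysis. -/

/-! ### Supporting lines and the double Legendre-Fenchel transform -/

theorem le_lfTransform_lfTransform {f : ℝ → EReal} {u a : ℝ} (hu : f u = a) {p t₁ t₂ a₁ a₂ v₁ v₂ : ℝ}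
    (h₁ : f v₁ = a₁) (h₂ : f v₂ = a₂) (ht₁ : 0 ≤ t₁) (ht₂ : 0 ≤ t₂) (ht : t₁ + t₂ = 1)
    (htu : t₁ * v₁ + t₂ * v₂ = u) (hp : p = t₁ * a₁ + t₂ * a₂) :
    (p : EReal) ≤ lfTransform (lfTransform f) u := by
  refine le_iInf fun β => ?_
  have le : ∀ v : ℝ, lfTransform f β ≤ ((β * v : ℝ) : EReal) - f v := fun v => iInf_le _ v
  have l₀ := le u
  have l₁ := le v₁
  have l₂ := le v₂
  rw [hu, ← EReal.coe_sub] at l₀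
  rw [h₁, ← EReal.coe_sub] at l₁
  rw [h₂, ← EReal.coe_sub] at l₂
  induction h : lfTransform f β with
  | bot => rw [EReal.coe_sub_bot]; exact le_top
  | top => rw [h] at l₀; exact absurd l₀ (not_le.2 (EReal.coe_lt_top _))
  | coe q =>
    rw [h, EReal.coe_le_coe_iff] at l₁ l₂
    rw [← EReal.coe_sub, EReal.coe_le_coe_iff]
    -- Averaging `q ≤ β vᵢ - aᵢ` with weights `tᵢ` gives `q ≤ β u - p`: the double transform lies
    -- above every chord of `f`.
    have e₁ := mul_le_mul_of_nonneg_left l₁ ht₁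
    have e₂ := mul_le_mul_of_nonneg_left l₂ ht₂
    have e : q = t₁ * q + t₂ * q := by rw [← add_mul, ht, one_mul]
    rw [hp, ← htu]
    linarith

/-- The supporting line gives `f^*(α) ≥ α u - a`, and testing `f^{**}(u)` at `β = α` bounds it by
`a`. The other inequality is the degenerate chord at `u`. -/
theorem lfTransform_lfTransform_eq_of_isSupportingSlope {f : ℝ → EReal} {u a α : ℝ} (hu : f u = a)
    (h : IsSupportingSlope f u α) : lfTransform (lfTransform f) u = f u := by
  refine le_antisymm ?_ ?_
  · have h1 : ((α * u - a : ℝ) : EReal) ≤ lfTransform f α := by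
      refine le_iInf fun v => ?_
      have := h v
      rw [hu, ← EReal.coe_add] at this
      induction hv : f v with
      | bot => rw [EReal.coe_sub_bot]; exact le_top
      | top => rw [hv] at this; exact absurd this (not_le.2 (EReal.coe_lt_top _))
      | coe y =>
        rw [hv, EReal.coe_le_coe_iff] at this
        rw [← EReal.coe_sub, EReal.coe_le_coe_iff]
        linarith
    refine (iInf_le _ α).trans ((EReal.sub_le_sub le_rfl h1).trans ?_)
    rw [hu, ← EReal.coe_sub, EReal.coe_le_coe_iff]
    linarith
  · rw [hu]
    exact le_lfTransform_lfTransform hu (t₁ := 1) (t₂ := 0) hu hu (by simp) (by simp) (by simp)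
      (by simp) (by simp)

/-- A point of the relative interior of the convex hull of `D ⊆ ℝ` lies strictly between two points
of `D`, unless it is the only point of `D`. -/
theorem exists_opposite_of_mem_intrinsicInterior {D : Set ℝ} {u v : ℝ}
    (hu : u ∈ intrinsicInterior ℝ (convexHull ℝ D)) (hv : v ∈ D) (hvu : v ≠ u) :
    ∃ w ∈ D, (w - u) * (v - u) < 0 := by
  by_contra! hcon
  have hhull : ∀ w ∈ convexHull ℝ D, 0 ≤ (w - u) * (v - u) := by
    have hconv : Convex ℝ {w : ℝ | 0 ≤ (w - u) * (v - u)} := by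
      intro x hx y hy a b ha hb hab
      simp only [Set.mem_ofPred_eq, smul_eq_mul] at hx hy ⊢
      have e : (a * x + b * y - u) * (v - u) =
          a * ((x - u) * (v - u)) + b * ((y - u) * (v - u)) := by
        linear_combination (u * (v - u)) * hab
      rw [e]
      positivity
    exact fun w hw => convexHull_min hcon hconv hw
  obtain ⟨y, hy, rfl⟩ := mem_intrinsicInterior.1 hu
  have hvs : v ∈ affineSpan ℝ (convexHull ℝ D) :=
    subset_affineSpan ℝ _ (subset_convexHull ℝ D hv)
  -- The line through `u` and `v` stays in the affine span, so for small `t < 0` it is still in the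
  -- hull, but on the side of `u` away from `v`.
  let γ : ℝ → affineSpan ℝ (convexHull ℝ D) := fun t =>
    ⟨AffineMap.lineMap (y : ℝ) v t, AffineMap.lineMap_mem t y.2 hvs⟩
  have hγ : Continuous γ := by
    refine Continuous.subtype_mk ?_ _
    exact AffineMap.lineMap_continuous
  have hγ0 : γ 0 = y := Subtype.ext (by simp [γ])
  have h1 : ∀ᶠ t in 𝓝 (0 : ℝ), γ t ∈ interior ((↑) ⁻¹' convexHull ℝ D) :=
    hγ.continuousAt.eventually (by rw [hγ0]; exact isOpen_interior.mem_nhds hy)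
  have h2 : ∀ᶠ t in 𝓝[<] (0 : ℝ), γ t ∈ interior ((↑) ⁻¹' convexHull ℝ D) :=
    h1.filter_mono nhdsWithin_le_nhds
  obtain ⟨t, ht, ht0⟩ := (h2.and self_mem_nhdsWithin).exists
  have h3 : γ t ∈ ((↑) ⁻¹' convexHull ℝ D : Set (affineSpan ℝ (convexHull ℝ D))) :=
    interior_subset ht
  replace h3 := hhull _ h3
  have ht0 : t < 0 := ht0
  have h4 : ((γ t : ℝ) - y) * (v - y) = t * (v - y) ^ 2 := by
    simp only [γ, AffineMap.lineMap_apply, vsub_eq_sub, vadd_eq_add, smul_eq_mul]; ring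
  have h5 : 0 < (v - (y : ℝ)) ^ 2 := by
    have := sub_ne_zero.2 hvu
    positivity
  rw [h4] at h3
  nlinarith

/-- Since `f^{**}` dominates chords, `f u = f^{**} u` puts every chord across `u` below `f u`:
slopes to the right of `u` are at most slopes to the left. Relative interiority supplies points on
both sides, so the supremum of the right slopes is finite and supports. -/
theorem exists_isSupportingSlope {f : ℝ → EReal} {u a : ℝ} (hu : f u = a)
    (hint : u ∈ intrinsicInterior ℝ (convexHull ℝ {v | f v ≠ ⊥}))
    (h : f u = lfTransform (lfTransform f) u) : ∃ α : ℝ, IsSupportingSlope f u α := by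
  have htop : ∀ v, f v ≠ ⊤ := fun v hv => by
    have h1 : ∀ β, lfTransform f β = ⊥ := fun β => by
      refine le_bot_iff.1 ((iInf_le _ v).trans ?_)
      rw [hv, EReal.sub_top]
    have h2 : lfTransform (lfTransform f) u = ⊤ := by
      rw [lfTransform]; simp only [h1, EReal.coe_sub_bot, iInf_top]
    rw [h2, hu] at h
    exact EReal.coe_ne_top _ h
  have hcoe : ∀ v ∈ {v | f v ≠ ⊥}, f v = ((f v).toReal : EReal) := fun v hv =>
    (EReal.coe_toReal (htop v) hv).symm
  by_cases hex : ∃ v ∈ {v | f v ≠ ⊥}, v ≠ u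
  swap
  -- Here `f` is `⊥` off `u`, so any slope works.
  · refine ⟨0, fun v => ?_⟩
    by_cases hv : v = u
    · subst hv; simp
    · have : f v = ⊥ := by by_contra hb; exact hex ⟨v, hb, hv⟩
      rw [this]; exact bot_le
  have hsides : (∃ l ∈ {v | f v ≠ ⊥}, l < u) ∧ ∃ r ∈ {v | f v ≠ ⊥}, u < r := by
    obtain ⟨v, hv, hvu⟩ := hex
    obtain ⟨w, hw, hlt⟩ := exists_opposite_of_mem_intrinsicInterior hint hv hvu
    rcases lt_or_gt_of_ne hvu with h1 | h1
    · exact ⟨⟨v, hv, h1⟩, w, hw, by nlinarith⟩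
    · exact ⟨⟨w, hw, by nlinarith⟩, v, hv, h1⟩
  have hslope : ∀ l ∈ {v | f v ≠ ⊥}, l < u → ∀ r ∈ {v | f v ≠ ⊥}, u < r →
      ((f r).toReal - a) / (r - u) ≤ (a - (f l).toReal) / (u - l) := by
    intro l hl hlu r hr hur
    have h1 : 0 < r - l := by linarith
    have h2 := le_lfTransform_lfTransform hu (hcoe l hl) (hcoe r hr)
      (t₁ := (r - u) / (r - l)) (t₂ := (u - l) / (r - l))
      (div_nonneg (by linarith) h1.le) (div_nonneg (by linarith) h1.le)
      (by field_simp; ring) (by field_simp; ring) rfl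
    rw [← h, hu, EReal.coe_le_coe_iff] at h2
    have e : (r - u) / (r - l) * (f l).toReal + (u - l) / (r - l) * (f r).toReal =
      ((r - u) * (f l).toReal + (u - l) * (f r).toReal) / (r - l) := by ring
    rw [e, div_le_iff₀ h1] at h2
    rw [div_le_div_iff₀ (by linarith) (by linarith)]
    linarith
  obtain ⟨⟨l₀, hl₀, hl₀u⟩, r₀, hr₀, hur₀⟩ := hsides
  let T : Set ℝ := {q | ∃ r ∈ {v | f v ≠ ⊥}, u < r ∧ q = ((f r).toReal - a) / (r - u)}
  have hT : BddAbove T := ⟨(a - (f l₀).toReal) / (u - l₀), by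
    rintro q ⟨r, hr, hur, rfl⟩; exact hslope l₀ hl₀ hl₀u r hr hur⟩
  refine ⟨sSup T, fun v => ?_⟩
  by_cases hv : f v = ⊥
  · rw [hv]; exact bot_le
  rw [hcoe v hv, hu, ← EReal.coe_add, EReal.coe_le_coe_iff]
  rcases lt_trichotomy v u with hvu | rfl | hvu
  · have h1 : sSup T ≤ (a - (f v).toReal) / (u - v) := by
      refine csSup_le ⟨_, r₀, hr₀, hur₀, rfl⟩ ?_
      rintro q ⟨r, hr, hur, rfl⟩
      exact hslope v hv hvu r hr hur
    rw [le_div_iff₀ (by linarith)] at h1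
    linarith
  · simp [hu]
  · have h1 : ((f v).toReal - a) / (v - u) ≤ sSup T := le_csSup hT ⟨v, hv, hvu, rfl⟩
    rw [div_le_iff₀ (by linarith)] at h1
    linarith

theorem IsSupportingSlope.eq_of_hasFiniteDerivAt {f : ℝ → EReal} {u α d : ℝ}
    (h : IsSupportingSlope f u α) (hd : HasFiniteDerivAt f d u) : α = d := by
  obtain ⟨hfin, hder⟩ := hd
  have hmax : IsLocalMax (fun v => (f v).toReal - α * v) u := by
    filter_upwards [hfin] with v hv
    have h1 := h v
    have hu := hfin.self_of_nhds
    rw [← EReal.coe_toReal hv.2 hv.1, ← EReal.coe_toReal hu.2 hu.1, ← EReal.coe_add,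
      EReal.coe_le_coe_iff] at h1
    linarith
  have := hmax.hasDerivAt_eq_zero (hder.sub ((hasDerivAt_id u).const_mul α))
  linarith

/-! ### Extended-real arithmetic and exponential growth rates -/

theorem EReal.le_of_forall_pos_le_add_coe {a b : EReal}
    (h : ∀ ε : ℝ, 0 < ε → a ≤ b + (ε : EReal)) : a ≤ b := by
  induction b with
  | top => exact le_top
  | bot => simpa using h 1 one_pos
  | coe b =>
    induction a with
    | bot => exact bot_le
    | top => have := h 1 one_pos; norm_cast at this
    | coe a =>
      norm_cast
      refine le_of_forall_pos_le_add fun ε hε => ?_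
      have := h ε hε
      norm_cast at this

theorem EReal.add_coe_le_iff {a b : EReal} {c : ℝ} :
    a + (c : EReal) ≤ b ↔ a ≤ b + ((-c : ℝ) : EReal) := by
  induction a <;> induction b <;>
    simp only [EReal.bot_add, EReal.top_add_coe, ← EReal.coe_add, EReal.coe_le_coe_iff, top_le_iff,
      le_bot_iff, bot_le, le_top, EReal.coe_ne_top, EReal.coe_ne_bot, top_ne_bot]
  constructor <;> intro h <;> linarith

theorem EReal.add_coe_lt_coe_iff {a : EReal} {c d : ℝ} :
    a + (c : EReal) < (d : EReal) ↔ a < ((d - c : ℝ) : EReal) := by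
  induction a
  · simp only [EReal.bot_add, EReal.bot_lt_coe]
  · norm_cast; constructor <;> intro h <;> linarith
  · simp

namespace ExpGrowth

theorem expGrowthSup_exp_mul_le (c : ℝ) (v : ℕ → ℝ≥0∞) :
    expGrowthSup (fun n => EReal.exp ((c : EReal) * n) * v n) ≤ expGrowthSup v + (c : EReal) := by
  rw [add_comm]
  refine (expGrowthSup_mul_le (u := fun n : ℕ => EReal.exp ((c : EReal) * n)) ?_ ?_).trans_eq ?_
    <;> simp [expGrowthSup_exp]

theorem expGrowthInf_exp_mul_le (c : ℝ) (v : ℕ → ℝ≥0∞) :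
    expGrowthInf (fun n => EReal.exp ((c : EReal) * n) * v n) ≤ expGrowthInf v + (c : EReal) := by
  rw [add_comm]
  refine (expGrowthInf_mul_le (u := fun n : ℕ => EReal.exp ((c : EReal) * n)) ?_ ?_).trans_eq ?_
    <;> simp [expGrowthSup_exp]

theorem le_expGrowthInf_exp_mul (c : ℝ) (v : ℕ → ℝ≥0∞) :
    expGrowthInf v + (c : EReal) ≤ expGrowthInf (fun n => EReal.exp ((c : EReal) * n) * v n) := by
  rw [add_comm]
  refine le_trans ?_ (le_expGrowthInf_mul (u := fun n : ℕ => EReal.exp ((c : EReal) * n)))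
  simp [expGrowthInf_exp]

/-- A frequent bound on `u` meets an eventual bound on `v`, hence one lower and one upper rate; the
factor `2` is subexponential. It lets a negligible remainder be dropped from a lower rate. -/
theorem expGrowthInf_add_le (u v : ℕ → ℝ≥0∞) :
    expGrowthInf (u + v) ≤ expGrowthInf u ⊔ expGrowthSup v := by
  refine (expGrowthInf_le_of_eventually_le (v := u ⊔ v) (b := 2) (by simp)
    (Eventually.of_forall fun n => ?_)).trans ?_
  · rw [Pi.add_apply, Pi.sup_apply, two_mul]
    exact add_le_add le_sup_left le_sup_right
  · refine expGrowthInf_le_iff.2 fun c hc => ?_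
    have h1 := frequently_le_exp ((le_sup_left).trans_lt hc)
    have h2 := eventually_le_exp ((le_sup_right).trans_lt hc)
    exact (h1.and_eventually h2).mono fun n hn => sup_le hn.1 hn.2

end ExpGrowth

open ExpGrowth

/-! ### Weights of events and thin energy shells -/

namespace ManyBodySystem

variable {X : Type*} [MeasurableSpace X] (S : ManyBodySystem X)

theorem measurable_h (n : ℕ) : Measurable (S.h n) := (S.measurable_H n).div_const _

theorem measurableSet_shell (u r : ℝ) (n : ℕ) : MeasurableSet (S.shell u r n) :=
  measurableSet_le (((S.measurable_h n).sub_const u).abs) measurable_const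

theorem shell_mono {u r r' : ℝ} (hr : r ≤ r') (n : ℕ) : S.shell u r n ⊆ S.shell u r' n :=
  fun _ hω => le_trans hω hr

/-- The unnormalized weight of a sequence of events. -/
noncomputable def eventWeight (g : ℝ → ℝ) (α : ℝ) (A : ∀ n, Set (S.Ω n)) (n : ℕ) : ℝ≥0∞ :=
  ∫⁻ ω in A n, S.weight g α n ω ∂(S.μ n)

variable {S}

theorem weight_eq_exp (g : ℝ → ℝ) (α : ℝ) (n : ℕ) (ω : S.Ω n) :
    S.weight g α n ω = EReal.exp (((-(α * S.h n ω + g (S.h n ω)) : ℝ) : EReal) * n) := by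
  have : (((-(α * S.h n ω + g (S.h n ω)) : ℝ) : EReal) * n)
      = ((-(n * α * S.h n ω) - n * g (S.h n ω) : ℝ) : EReal) := by
    rw [← EReal.coe_natCast, ← EReal.coe_mul]; congr 1; ring
  rw [this, EReal.exp_coe, weight]

theorem exp_coe_mul_natCast_le {c d : ℝ} (h : c ≤ d) (n : ℕ) :
    EReal.exp ((c : EReal) * n) ≤ EReal.exp ((d : EReal) * n) := by
  have : (c : EReal) ≤ d := by exact_mod_cast h
  gcongr

theorem eventWeight_mono {g : ℝ → ℝ} {α : ℝ} {A B : ∀ n, Set (S.Ω n)} {n : ℕ} (h : A n ⊆ B n) :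
    S.eventWeight g α A n ≤ S.eventWeight g α B n :=
  lintegral_mono_set h

theorem eventWeight_le_partitionFunction (g : ℝ → ℝ) (α : ℝ) (A : ∀ n, Set (S.Ω n)) (n : ℕ) :
    S.eventWeight g α A n ≤ S.partitionFunction g α n :=
  setLIntegral_le_lintegral _ _

theorem eventWeight_union_le (g : ℝ → ℝ) (α : ℝ) (A B : ∀ n, Set (S.Ω n)) (n : ℕ) :
    S.eventWeight g α (fun n => A n ∪ B n) n ≤ S.eventWeight g α A n + S.eventWeight g α B n :=
  lintegral_union_le _ _ _

theorem expGrowthSup_eventWeight_union_le (g : ℝ → ℝ) (α : ℝ) (A B : ∀ n, Set (S.Ω n)) :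
    expGrowthSup (S.eventWeight g α (fun n => A n ∪ B n)) ≤
      expGrowthSup (S.eventWeight g α A) ⊔ expGrowthSup (S.eventWeight g α B) := by
  rw [← expGrowthSup_add]
  exact expGrowthSup_monotone (eventWeight_union_le g α A B)

theorem eventWeight_le {g : ℝ → ℝ} {α c : ℝ} {A : ∀ n, Set (S.Ω n)} {n : ℕ}
    (hA : MeasurableSet (A n)) (h : ∀ ω ∈ A n, c ≤ α * S.h n ω + g (S.h n ω)) :
    S.eventWeight g α A n ≤ EReal.exp (((-c : ℝ) : EReal) * n) * S.μ n (A n) := by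
  rw [← setLIntegral_const]
  refine setLIntegral_mono' hA fun ω hω => ?_
  rw [weight_eq_exp]
  exact exp_coe_mul_natCast_le (neg_le_neg (h ω hω)) n

theorem le_eventWeight {g : ℝ → ℝ} {α c : ℝ} {A : ∀ n, Set (S.Ω n)} {n : ℕ}
    (hA : MeasurableSet (A n)) (h : ∀ ω ∈ A n, α * S.h n ω + g (S.h n ω) ≤ c) :
    EReal.exp (((-c : ℝ) : EReal) * n) * S.μ n (A n) ≤ S.eventWeight g α A n := by
  rw [← setLIntegral_const]
  refine setLIntegral_mono' hA fun ω hω => ?_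
  rw [weight_eq_exp]
  exact exp_coe_mul_natCast_le (neg_le_neg (h ω hω)) n

theorem exists_shell_abs_sub_le {g : ℝ → ℝ} (hg : Continuous g) (S : ManyBodySystem X)
    (α v : ℝ) {ε : ℝ} (hε : 0 < ε) :
    ∃ δ > 0, ∀ n, ∀ ω ∈ S.shell v δ n,
      |(α * S.h n ω + g (S.h n ω)) - (α * v + g v)| ≤ ε := by
  have hc : Continuous fun w => α * w + g w := by fun_prop
  obtain ⟨δ, hδ, h⟩ := Metric.continuousAt_iff.1 (hc.continuousAt (x := v)) ε hε
  refine ⟨δ / 2, by positivity, fun n ω hω => ?_⟩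
  have : dist (S.h n ω) v < δ := by
    rw [Real.dist_eq]; exact lt_of_le_of_lt hω (by linarith)
  exact (h this).le

/-- Inside a thin energy shell the weight is almost constant, so that the growth rates of the
weight and of the reference measure differ by almost a constant. -/
theorem exists_shell_growth {g : ℝ → ℝ} (hg : Continuous g) (S : ManyBodySystem X)
    (α v : ℝ) {ε : ℝ} (hε : 0 < ε) :
    ∃ δ > 0, ∀ A : ∀ n, Set (S.Ω n), (∀ n, MeasurableSet (A n)) → (∀ n, A n ⊆ S.shell v δ n) →
      expGrowthSup (S.eventWeight g α A) ≤
        expGrowthSup (fun n => S.μ n (A n)) + ((-(α * v + g v) + ε : ℝ) : EReal) ∧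
      expGrowthInf (S.eventWeight g α A) ≤
        expGrowthInf (fun n => S.μ n (A n)) + ((-(α * v + g v) + ε : ℝ) : EReal) ∧
      expGrowthInf (fun n => S.μ n (A n)) + ((-(α * v + g v) - ε : ℝ) : EReal) ≤
        expGrowthInf (S.eventWeight g α A) := by
  obtain ⟨δ, hδ, h⟩ := exists_shell_abs_sub_le hg S α v hε
  refine ⟨δ, hδ, fun A hA hAs => ?_⟩
  have e1 : -(α * v + g v) + ε = -((α * v + g v) - ε) := by ring
  have e2 : -(α * v + g v) - ε = -((α * v + g v) + ε) := by ring
  have hle : ∀ n : ℕ, S.eventWeight g α A n ≤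
      EReal.exp (((-((α * v + g v) - ε) : ℝ) : EReal) * n) * S.μ n (A n) := fun n =>
    eventWeight_le (hA n) fun ω hω => by linarith [(abs_le.1 (h n ω (hAs n hω))).1]
  have hge : ∀ n : ℕ, EReal.exp (((-((α * v + g v) + ε) : ℝ) : EReal) * n) * S.μ n (A n) ≤
      S.eventWeight g α A n := fun n =>
    le_eventWeight (hA n) fun ω hω => by linarith [(abs_le.1 (h n ω (hAs n hω))).2]
  rw [e1, e2]
  exact ⟨(expGrowthSup_monotone hle).trans (expGrowthSup_exp_mul_le _ _),
    (expGrowthInf_monotone hle).trans (expGrowthInf_exp_mul_le _ _),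
    (le_expGrowthInf_exp_mul _ _).trans (expGrowthInf_monotone hge)⟩

/-- Shells shrink with their width, so the limiting rate is below the rate at each width. -/
theorem IsMicrocanonicalEntropy.le_expGrowthInf_shell {s : ℝ → EReal}
    (hs : S.IsMicrocanonicalEntropy s) (v : ℝ) {r : ℝ} (hr : 0 < r) :
    s v ≤ expGrowthInf fun n => S.μ n (S.shell v r n) := by
  refine le_of_tendsto (hs v).1 ?_
  filter_upwards [Ioo_mem_nhdsGT hr] with r' hr'
  exact expGrowthInf_monotone fun n => measure_mono (S.shell_mono hr'.2.le n)

theorem IsMicrocanonicalEntropy.exists_expGrowthSup_shell_lt {s : ℝ → EReal}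
    (hs : S.IsMicrocanonicalEntropy s) {v : ℝ} {c : EReal} (hc : s v < c) {δ : ℝ} (hδ : 0 < δ) :
    ∃ r > 0, r ≤ δ ∧ (expGrowthSup fun n => S.μ n (S.shell v r n)) < c := by
  have := ((hs v).2.eventually (gt_mem_nhds hc)).and (Ioo_mem_nhdsGT hδ)
  obtain ⟨r, h1, h2⟩ := this.exists
  exact ⟨r, h2.1, h2.2.le, h1⟩

/-- The lower half of Laplace's principle: `Z` is at least the weight of one thin shell about `v`.
No admissibility of `α` is needed. -/
theorem IsMicrocanonicalEntropy.le_expGrowthInf_partitionFunction {s : ℝ → EReal}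
    (hs : S.IsMicrocanonicalEntropy s) {g : ℝ → ℝ} (hg : Continuous g) (α v : ℝ) :
    s v + ((-(α * v + g v) : ℝ) : EReal) ≤ expGrowthInf (S.partitionFunction g α) := by
  refine EReal.le_of_forall_pos_le_add_coe fun ε hε => ?_
  obtain ⟨δ, hδ, h⟩ := exists_shell_growth hg S α v hε
  have h3 := (h (S.shell v δ) (S.measurableSet_shell v δ) fun n => le_rfl).2.2
  have h4 := (add_le_add_left (hs.le_expGrowthInf_shell v hδ)
    ((-(α * v + g v) - ε : ℝ) : EReal)).trans (h3.trans
      (expGrowthInf_monotone (eventWeight_le_partitionFunction g α _)))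
  rw [EReal.add_coe_le_iff] at h4 ⊢
  rw [add_assoc, ← EReal.coe_add]
  convert h4 using 3
  ring

end ManyBodySystem

/-! ### Microcanonical equilibrium and upper bounds of Laplace type -/

namespace ManyBodySystem

variable {X : Type*} [MeasurableSpace X] {S : ManyBodySystem X}

theorem expGrowthInf_prob_le_zero {u : ℕ → ℝ≥0∞} (h : ∀ n, u n ≤ 1) : expGrowthInf u ≤ 0 := by
  refine (expGrowthInf_monotone (show u ≤ fun _ => 1 from h)).trans_eq (expGrowthInf_const ?_ ?_) <;> simp

theorem microcanonical_apply (u r : ℝ) (n : ℕ) (A : Set (S.Ω n)) :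
    S.microcanonical u r n A = (S.μ n (S.shell u r n))⁻¹ * S.μ n (S.shell u r n ∩ A) :=
  ProbabilityTheory.cond_apply (S.measurableSet_shell u r n) _ _

/-- A macrostate is in microcanonical equilibrium iff the entropy of each of its neighbourhoods is
the full entropy of the energy shells. -/
theorem mem_microEquilibrium_iff [TopologicalSpace X] {s : ℝ → EReal}
    (hs : S.IsMicrocanonicalEntropy s) {u σ : ℝ} (hu : s u = σ) {x : X} :
    x ∈ S.microEquilibrium u ↔ ∀ U : Set X, IsOpen U → x ∈ U → ∀ r : ℝ, 0 < r →
      (σ : EReal) ≤ expGrowthInf fun n => S.μ n (S.shell u r n ∩ S.m n ⁻¹' U) := by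
  refine forall₃_congr fun U _ _ => ⟨fun h r hr => ?_, fun h => ?_⟩
  · refine EReal.le_of_forall_pos_le_add_coe fun ε hε => ?_
    have hlow : ((-ε : ℝ) : EReal) < 0 := by exact_mod_cast neg_lt_zero.2 hε
    -- This bound only makes the shell rate `τ` finite, so that it can be divided out; the estimate
    -- itself uses `σ ≤ τ`.
    have hup : s u < ((σ + 1 : ℝ) : EReal) := by rw [hu]; exact_mod_cast lt_add_one σ
    have ev := ((h.eventually (lt_mem_nhds hlow)).and
      ((hs u).1.eventually (gt_mem_nhds hup))).and (Ioo_mem_nhdsGT hr)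
    obtain ⟨r', ⟨h1, h2⟩, h3⟩ := ev.exists
    have h4 := hs.le_expGrowthInf_shell u h3.1
    rw [hu] at h4
    obtain ⟨τ, hτ⟩ : ∃ τ : ℝ, (expGrowthInf fun n => S.μ n (S.shell u r' n)) = τ :=
      ⟨_, (EReal.coe_toReal h2.ne_top ((EReal.bot_lt_coe _).trans_le h4).ne').symm⟩
    have h5 : expGrowthInf ((fun n => (S.μ n (S.shell u r' n)))⁻¹ *
        fun n => S.μ n (S.shell u r' n ∩ S.m n ⁻¹' U)) ≤ ((-τ : ℝ) : EReal) +
        expGrowthInf fun n => S.μ n (S.shell u r' n ∩ S.m n ⁻¹' U) := by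
      refine (expGrowthInf_mul_le ?_ ?_).trans_eq ?_ <;> rw [expGrowthSup_inv, hτ]
      · left; rw [← EReal.coe_neg]; exact EReal.coe_ne_bot _
      · left; rw [← EReal.coe_neg]; exact EReal.coe_ne_top _
      · rw [EReal.coe_neg]
    simp only [microcanonical_apply] at h1
    have h6 := h1.le.trans h5
    have h7 : (expGrowthInf fun n => S.μ n (S.shell u r' n ∩ S.m n ⁻¹' U)) ≤
        expGrowthInf fun n => S.μ n (S.shell u r n ∩ S.m n ⁻¹' U) :=
      expGrowthInf_monotone fun n => measure_mono
        (Set.inter_subset_inter_left _ (S.shell_mono h3.2.le n))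
    refine le_trans ?_ (add_le_add_left h7 _)
    rw [hτ] at h4
    have h8 := EReal.coe_le_coe_iff.1 h4
    generalize (expGrowthInf fun n => S.μ n (S.shell u r' n ∩ S.m n ⁻¹' U)) = y at h6 ⊢
    induction y with
    | bot => rw [EReal.add_bot, le_bot_iff] at h6; exact absurd h6 (EReal.coe_ne_bot _)
    | top => rw [EReal.top_add_coe]; exact le_top
    | coe y =>
      norm_cast at h6 ⊢
      linarith
  · have h0 : Tendsto (fun r : ℝ => -(expGrowthSup fun n => S.μ n (S.shell u r n)) + (σ : EReal))
        (𝓝[>] 0) (𝓝 0) := by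
      have h1 : Tendsto (fun r : ℝ => -(expGrowthSup fun n => S.μ n (S.shell u r n)))
          (𝓝[>] 0) (𝓝 (((-σ : ℝ) : EReal))) := by
        rw [EReal.coe_neg, ← hu]; exact (continuous_neg.tendsto _).comp (hs u).2
      have h2 := (EReal.continuousAt_add_coe_coe (-σ) σ).tendsto.comp
        (h1.prodMk_nhds (tendsto_const_nhds (x := (σ : EReal))))
      have e : (0 : EReal) = ((-σ : ℝ) : EReal) + (σ : EReal) := by
        rw [← EReal.coe_add, neg_add_cancel, EReal.coe_zero]
      rw [e]
      exact h2
    refine tendsto_of_tendsto_of_tendsto_of_le_of_le' h0 tendsto_const_nhds ?_ ?_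
    · filter_upwards [self_mem_nhdsWithin] with r hr
      simp only [microcanonical_apply]
      refine le_trans ?_ (le_expGrowthInf_mul (u := (fun n => (S.μ n (S.shell u r n)))⁻¹))
      rw [expGrowthInf_inv]
      exact add_le_add_right (h r hr) _
    · refine Eventually.of_forall fun r => expGrowthInf_prob_le_zero fun n => ?_
      rw [microcanonical_apply]
      exact (mul_le_mul_right (measure_mono Set.inter_subset_left) _).trans
        (ENNReal.inv_mul_le_one _)

/-- The rate of a finite union is the maximum of the rates, so the strict bound, valid on a small
ball about each point, passes to a compact set. -/
theorem expGrowthSup_eventWeight_lt_of_compact {s : ℝ → EReal} (hs : S.IsMicrocanonicalEntropy s)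
    {g : ℝ → ℝ} (hg : Continuous g) {α c : ℝ} {K : Set ℝ} (hK : IsCompact K)
    (h : ∀ v ∈ K, s v + ((-(α * v + g v) : ℝ) : EReal) < c) :
    expGrowthSup (S.eventWeight g α fun n => S.h n ⁻¹' K) < c := by
  refine hK.induction_on
    (p := fun K => expGrowthSup (S.eventWeight g α fun n => S.h n ⁻¹' K) < c) ?_ ?_ ?_ ?_
  · have : (S.eventWeight g α fun n => S.h n ⁻¹' ∅) = 0 := by
      funext n; simp [eventWeight]
    rw [this, expGrowthSup_zero]
    exact EReal.bot_lt_coe c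
  · intro A B hAB hB
    exact (expGrowthSup_monotone fun n => eventWeight_mono fun _ hω => hAB hω).trans_lt hB
  · intro A B hA hB
    exact (expGrowthSup_eventWeight_union_le g α (fun n => S.h n ⁻¹' A)
      fun n => S.h n ⁻¹' B).trans_lt (sup_lt_iff.2 ⟨hA, hB⟩)
  · intro v hv
    have h1 := h v hv
    rw [EReal.add_coe_lt_coe_iff] at h1
    obtain ⟨b, h2, h3⟩ := EReal.exists_between_coe_real h1
    rw [EReal.coe_lt_coe_iff] at h3
    set ε := (c - -(α * v + g v) - b) / 2 with hε
    have hε0 : 0 < ε := by rw [hε]; linarith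
    obtain ⟨δ, hδ, hW⟩ := exists_shell_growth hg S α v hε0
    obtain ⟨r, hr, hrδ, hlt⟩ := hs.exists_expGrowthSup_shell_lt h2 hδ
    refine ⟨Metric.closedBall v r,
      mem_nhdsWithin_of_mem_nhds (Metric.closedBall_mem_nhds v hr), ?_⟩
    refine (hW (S.shell v r) (S.measurableSet_shell v r) fun n => S.shell_mono hrδ n).1.trans_lt ?_
    refine (add_le_add_left hlt.le _).trans_lt ?_
    norm_cast
    linarith

/-- The energies far from `0` have negligible weight when `α` is admissible. -/
theorem exists_expGrowthSup_tail_lt {g : ℝ → ℝ} {α : ℝ}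
    (hα : α ∈ S.admissibleParams g) (c : ℝ) :
    ∃ R : ℝ, expGrowthSup (S.eventWeight g α fun n => S.h n ⁻¹' {v | R ≤ |v|}) < c := by
  obtain ⟨ε, hε, hball⟩ := Metric.isOpen_iff.1 isOpen_interior α hα
  have key : ∀ β : ℝ, dist β α < ε → ∃ C : ℝ,
      expGrowthSup (S.partitionFunction g β) ≤ C := fun β hβ => by
    have h0 : β ∈ {α | expGrowthSup (S.partitionFunction g α) < ⊤} :=
      interior_subset (hball hβ)
    have h1 : expGrowthSup (S.partitionFunction g β) < ⊤ := h0
    induction h : expGrowthSup (S.partitionFunction g β) with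
    | bot => exact ⟨0, bot_le⟩
    | coe y => exact ⟨y, le_rfl⟩
    | top => exact absurd h h1.ne
  obtain ⟨C₁, h₁⟩ := key (α - ε / 2) (by rw [Real.dist_eq]; rw [abs_lt]; constructor <;> linarith)
  obtain ⟨C₂, h₂⟩ := key (α + ε / 2) (by rw [Real.dist_eq]; rw [abs_lt]; constructor <;> linarith)
  -- Exponential Markov bound: passing from `β` to `α` multiplies the weight by `exp (-n (α - β)
  -- h)`. Interiority allows `β` on either side of `α`, one for each tail.
  have tail : ∀ (β R : ℝ) (A : ∀ n, Set (S.Ω n)), (∀ n, MeasurableSet (A n)) →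
      (∀ n, ∀ ω ∈ A n, R ≤ (α - β) * S.h n ω) →
      expGrowthSup (S.eventWeight g α A) ≤
        expGrowthSup (S.partitionFunction g β) + ((-R : ℝ) : EReal) := fun β R A hA hR => by
    refine (expGrowthSup_monotone fun n => ?_).trans (expGrowthSup_exp_mul_le _ _)
    refine le_trans ?_ (mul_le_mul_right (setLIntegral_le_lintegral (A n) _) _)
    rw [← lintegral_const_mul' _ _ (by
      rw [← EReal.coe_natCast, ← EReal.coe_mul, Ne, EReal.exp_eq_top_iff]
      exact EReal.coe_ne_top _)]
    refine setLIntegral_mono' (hA n) fun ω hω => ?_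
    rw [weight_eq_exp, weight_eq_exp, ← EReal.exp_add]
    have e : ((-R : ℝ) : EReal) * n + ((-(β * S.h n ω + g (S.h n ω)) : ℝ) : EReal) * n
        = ((-R + -(β * S.h n ω + g (S.h n ω)) : ℝ) : EReal) * n := by
      rw [← EReal.coe_natCast, ← EReal.coe_mul, ← EReal.coe_mul, ← EReal.coe_mul, ← EReal.coe_add]
      congr 1; ring
    rw [e]
    refine exp_coe_mul_natCast_le ?_ n
    linarith [hR n ω hω]
  -- Chosen so that both `C₁ - ε / 2 * R` and `C₂ - ε / 2 * R` are below `c`.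
  set R : ℝ := 2 * (|C₁| + |C₂| + |c| + 1) / ε with hR
  have hRε : ε / 2 * R = |C₁| + |C₂| + |c| + 1 := by rw [hR]; field_simp
  refine ⟨R, ?_⟩
  have hset : (fun n => S.h n ⁻¹' {v | R ≤ |v|}) =
      fun n => (S.h n ⁻¹' {v | R ≤ v}) ∪ (S.h n ⁻¹' {v | R ≤ -v}) := by
    funext n; ext ω; simp [le_abs]
  rw [hset]
  refine (expGrowthSup_eventWeight_union_le _ _ _ _).trans_lt (sup_lt_iff.2 ⟨?_, ?_⟩)
  · refine (tail (α - ε / 2) (ε / 2 * R) _ (fun n => S.measurable_h n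
      (measurableSet_le measurable_const measurable_id)) ?_).trans_lt ?_
    · intro n ω hω
      have : R ≤ S.h n ω := hω
      rw [sub_sub_cancel]
      exact mul_le_mul_of_nonneg_left this (by positivity)
    · refine (add_le_add_left h₁ _).trans_lt ?_
      norm_cast
      rw [hRε]
      linarith [le_abs_self C₁, abs_nonneg C₂, neg_abs_le c]
  · refine (tail (α + ε / 2) (ε / 2 * R) _ (fun n => S.measurable_h n
      (measurableSet_le measurable_const measurable_id.neg)) ?_).trans_lt ?_
    · intro n ω hω
      have : R ≤ -S.h n ω := hω
      have := mul_le_mul_of_nonneg_left this (show 0 ≤ ε / 2 by positivity)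
      linarith
    · refine (add_le_add_left h₂ _).trans_lt ?_
      norm_cast
      rw [hRε]
      linarith [le_abs_self C₂, abs_nonneg C₁, neg_abs_le c]

end ManyBodySystem

/-! ### Strict supporting lines and equivalence of ensembles -/

theorem modifiedEntropy_le_iff {s : ℝ → EReal} {g : ℝ → ℝ} {u σ : ℝ} (hu : s u = σ) (α v : ℝ) :
    modifiedEntropy s g v ≤ modifiedEntropy s g u + ((α * (v - u) : ℝ) : EReal) ↔
      s v + ((-(α * v + g v) : ℝ) : EReal) ≤ ((σ - (α * u + g u) : ℝ) : EReal) := by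
  rw [modifiedEntropy, modifiedEntropy, hu, ← EReal.coe_sub, ← EReal.coe_add, sub_eq_add_neg,
    ← EReal.coe_neg]
  induction s v <;>
    simp only [EReal.bot_add, EReal.top_add_coe, ← EReal.coe_add, EReal.coe_le_coe_iff, bot_le,
      top_le_iff, EReal.coe_ne_top]
  constructor <;> intro h <;> linarith

theorem modifiedEntropy_lt_iff {s : ℝ → EReal} {g : ℝ → ℝ} {u σ : ℝ} (hu : s u = σ) (α v : ℝ) :
    modifiedEntropy s g v < modifiedEntropy s g u + ((α * (v - u) : ℝ) : EReal) ↔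
      s v + ((-(α * v + g v) : ℝ) : EReal) < ((σ - (α * u + g u) : ℝ) : EReal) := by
  rw [modifiedEntropy, modifiedEntropy, hu, ← EReal.coe_sub, ← EReal.coe_add, sub_eq_add_neg,
    ← EReal.coe_neg]
  induction s v <;>
    simp only [EReal.bot_add, EReal.top_add_coe, ← EReal.coe_add, EReal.coe_lt_coe_iff,
      EReal.bot_lt_coe, not_top_lt]
  constructor <;> intro h <;> linarith

theorem IsStrictSupportingSlope.isSupportingSlope {f : ℝ → EReal} {u α : ℝ}
    (h : IsStrictSupportingSlope f u α) : IsSupportingSlope f u α := fun v => by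
  by_cases hv : v = u
  · subst hv; simp
  · exact (h v hv).le

namespace ManyBodySystem

variable {X : Type*} [MeasurableSpace X] {S : ManyBodySystem X}

theorem generalizedCanonical_apply (g : ℝ → ℝ) (α : ℝ) {A : ∀ n, Set (S.Ω n)}
    (hA : ∀ n, MeasurableSet (A n)) (n : ℕ) :
    S.generalizedCanonical g α n (A n) =
      (S.partitionFunction g α n)⁻¹ * S.eventWeight g α A n := by
  rw [generalizedCanonical, Measure.smul_apply, smul_eq_mul, withDensity_apply _ (hA n),
    eventWeight]

theorem partitionFunction_eq_eventWeight_add_compl (g : ℝ → ℝ) (α : ℝ) {A : ∀ n, Set (S.Ω n)}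
    (hA : ∀ n, MeasurableSet (A n)) :
    S.partitionFunction g α =
      S.eventWeight g α A + S.eventWeight g α fun n => (A n)ᶜ := by
  funext n
  exact (lintegral_add_compl _ (hA n)).symm

/-- Outside any energy shell about the point of contact of a strict supporting line, the weight is
exponentially smaller than the partition function. -/
theorem expGrowthSup_compl_shell_lt {s : ℝ → EReal} (hs : S.IsMicrocanonicalEntropy s)
    {g : ℝ → ℝ} (hg : Continuous g) {u σ α r : ℝ} (hu : s u = σ)
    (hα : α ∈ S.admissibleParams g) (hstrict : IsStrictSupportingSlope (modifiedEntropy s g) u α)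
    (hr : 0 < r) :
    expGrowthSup (S.eventWeight g α fun n => (S.shell u r n)ᶜ) <
      ((σ - (α * u + g u) : ℝ) : EReal) := by
  obtain ⟨R, hR⟩ := exists_expGrowthSup_tail_lt hα (σ - (α * u + g u))
  -- Removing the open ball keeps `K` compact and away from `u`; with the tail it covers the
  -- energies outside the shell.
  let K : Set ℝ := Metric.closedBall 0 R ∩ (Metric.ball u r)ᶜ
  have hK : IsCompact K := (isCompact_closedBall 0 R).inter_right Metric.isOpen_ball.isClosed_compl
  have hKlt := expGrowthSup_eventWeight_lt_of_compact hs hg hK fun v hv =>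
    (modifiedEntropy_lt_iff hu α v).1 <| hstrict v fun h => hv.2 (by
      rw [h]; exact Metric.mem_ball_self hr)
  refine lt_of_le_of_lt ((expGrowthSup_monotone fun n => eventWeight_mono ?_).trans
    (expGrowthSup_eventWeight_union_le g α (fun n => S.h n ⁻¹' K)
      fun n => S.h n ⁻¹' {v | R ≤ |v|})) (sup_lt_iff.2 ⟨hKlt, hR⟩)
  intro ω hω
  have h1 : r < |S.h n ω - u| := not_le.1 hω
  rcases le_total (|S.h n ω|) R with h | h
  · refine Or.inl ⟨?_, fun h2 => ?_⟩
    · rw [Metric.mem_closedBall, Real.dist_eq, sub_zero]; exact h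
    · rw [Metric.mem_ball, Real.dist_eq] at h2
      exact absurd h2 h1.not_gt
  · exact Or.inr h

/-- At a strict supporting line the free energy is determined by its point of contact. -/
theorem expGrowth_partitionFunction_eq {s : ℝ → EReal} (hs : S.IsMicrocanonicalEntropy s)
    {g : ℝ → ℝ} (hg : Continuous g) {u σ α : ℝ} (hu : s u = σ)
    (hα : α ∈ S.admissibleParams g) (hstrict : IsStrictSupportingSlope (modifiedEntropy s g) u α) :
    expGrowthInf (S.partitionFunction g α) = ((σ - (α * u + g u) : ℝ) : EReal) ∧
      expGrowthSup (S.partitionFunction g α) = ((σ - (α * u + g u) : ℝ) : EReal) := by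
  have hlow : ((σ - (α * u + g u) : ℝ) : EReal) ≤ expGrowthInf (S.partitionFunction g α) := by
    refine le_trans (le_of_eq ?_) (hs.le_expGrowthInf_partitionFunction hg α u)
    rw [hu, ← EReal.coe_add, sub_eq_add_neg]
  have hup : expGrowthSup (S.partitionFunction g α) ≤ ((σ - (α * u + g u) : ℝ) : EReal) := by
    refine EReal.le_of_forall_pos_le_add_coe fun ε hε => ?_
    obtain ⟨δ, hδ, hW⟩ := exists_shell_growth hg S α u (half_pos hε)
    have hlt : s u < ((σ + ε / 2 : ℝ) : EReal) := by
      rw [hu, EReal.coe_lt_coe_iff]; linarith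
    obtain ⟨r, hr, hrδ, hr2⟩ := hs.exists_expGrowthSup_shell_lt hlt hδ
    rw [partitionFunction_eq_eventWeight_add_compl g α (S.measurableSet_shell u r),
      expGrowthSup_add, ← EReal.coe_add]
    refine sup_le ?_ ((expGrowthSup_compl_shell_lt hs hg hu hα hstrict hr).le.trans ?_)
    · refine (hW _ (S.measurableSet_shell u r) fun n => S.shell_mono hrδ n).1.trans ?_
      refine (add_le_add_left hr2.le _).trans ?_
      rw [← EReal.coe_add, EReal.coe_le_coe_iff]
      linarith
    · rw [EReal.coe_le_coe_iff]; linarith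
  have hle : expGrowthInf (S.partitionFunction g α) ≤ expGrowthSup (S.partitionFunction g α) :=
    expGrowthInf_le_expGrowthSup
  exact ⟨le_antisymm (hle.trans hup) hlow, le_antisymm hup (hlow.trans hle)⟩

/-- As the lower and upper rates of `Z` agree, normalization shifts lower rates by exactly `-a`;
they never exceed `0`, so only one inequality remains. -/
theorem mem_canonEquilibrium_iff [TopologicalSpace X] [BorelSpace X] {g : ℝ → ℝ} {α a : ℝ}
    (hinf : expGrowthInf (S.partitionFunction g α) = a)
    (hsup : expGrowthSup (S.partitionFunction g α) = a) {x : X} :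
    x ∈ S.canonEquilibrium g α ↔ ∀ U : Set X, IsOpen U → x ∈ U →
      (a : EReal) ≤ expGrowthInf (S.eventWeight g α fun n => S.m n ⁻¹' U) := by
  refine forall₃_congr fun U hU _ => ?_
  have hmeas : ∀ n, MeasurableSet (S.m n ⁻¹' U) := fun n => S.measurable_m n hU.measurableSet
  have e : (fun n => S.generalizedCanonical g α n (S.m n ⁻¹' U)) =
      (S.partitionFunction g α)⁻¹ * S.eventWeight g α fun n => S.m n ⁻¹' U :=
    funext fun n => generalizedCanonical_apply g α hmeas n
  have hW : expGrowthInf (S.eventWeight g α fun n => S.m n ⁻¹' U) ≤ a :=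
    hinf ▸ expGrowthInf_monotone (eventWeight_le_partitionFunction g α _)
  have hval : expGrowthInf (fun n => S.generalizedCanonical g α n (S.m n ⁻¹' U)) =
      ((-a : ℝ) : EReal) + expGrowthInf (S.eventWeight g α fun n => S.m n ⁻¹' U) := by
    rw [e]
    refine le_antisymm ((expGrowthInf_mul_le ?_ ?_).trans_eq ?_) (le_trans (le_of_eq ?_)
      le_expGrowthInf_mul)
    · left; rw [expGrowthSup_inv, hinf, ← EReal.coe_neg]; exact EReal.coe_ne_bot _
    · left; rw [expGrowthSup_inv, hinf, ← EReal.coe_neg]; exact EReal.coe_ne_top _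
    · rw [expGrowthSup_inv, hinf, EReal.coe_neg]
    · rw [expGrowthInf_inv, hsup, EReal.coe_neg]
  rw [hval]
  generalize expGrowthInf (S.eventWeight g α fun n => S.m n ⁻¹' U) = y at hW ⊢
  induction y with
  | bot => simp
  | top => exact absurd hW (not_le.2 (EReal.coe_lt_top _))
  | coe y =>
    norm_cast at hW ⊢
    constructor <;> intro h <;> linarith

theorem microEquilibrium_eq_canonEquilibrium [TopologicalSpace X] [BorelSpace X]
    {s : ℝ → EReal} (hs : S.IsMicrocanonicalEntropy s)
    {g : ℝ → ℝ} (hg : Continuous g) {u σ α : ℝ} (hu : s u = σ)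
    (hα : α ∈ S.admissibleParams g) (hstrict : IsStrictSupportingSlope (modifiedEntropy s g) u α) :
    S.microEquilibrium u = S.canonEquilibrium g α := by
  obtain ⟨hinf, hsup⟩ := expGrowth_partitionFunction_eq hs hg hu hα hstrict
  ext x
  rw [mem_microEquilibrium_iff hs hu, mem_canonEquilibrium_iff hinf hsup]
  refine forall₃_congr fun U hU _ => ?_
  have hmeas : ∀ r n, MeasurableSet (S.shell u r n ∩ S.m n ⁻¹' U) := fun r n =>
    (S.measurableSet_shell u r n).inter (S.measurable_m n hU.measurableSet)
  refine ⟨fun h => ?_, fun h r hr => ?_⟩ <;>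
    refine EReal.le_of_forall_pos_le_add_coe fun ε hε => ?_ <;>
    obtain ⟨δ, hδ, hW⟩ := exists_shell_growth hg S α u hε
  · have h1 := (hW _ (hmeas δ) fun n => Set.inter_subset_left).2.2
    have h2 : expGrowthInf (S.eventWeight g α fun n => S.shell u δ n ∩ S.m n ⁻¹' U) ≤
        expGrowthInf (S.eventWeight g α fun n => S.m n ⁻¹' U) :=
      expGrowthInf_monotone fun n => eventWeight_mono Set.inter_subset_right
    have h3 := (add_le_add_left (h δ hδ) _).trans (h1.trans h2)
    refine le_trans (le_of_eq ?_) (add_le_add_left h3 _)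
    rw [← EReal.coe_add, ← EReal.coe_add]
    congr 1; ring
  · set ρ := min r δ
    have hρ : 0 < ρ := lt_min hr hδ
    have h1 := (hW _ (hmeas ρ) fun n => Set.inter_subset_left.trans
      (S.shell_mono (min_le_right r δ) n)).2.1
    have h2 : expGrowthInf (S.eventWeight g α fun n => S.m n ⁻¹' U) ≤
        expGrowthInf (S.eventWeight g α fun n => S.shell u ρ n ∩ S.m n ⁻¹' U) ⊔
          expGrowthSup (S.eventWeight g α fun n => (S.shell u ρ n)ᶜ) := by
      refine le_trans (expGrowthInf_monotone fun n => ?_) (expGrowthInf_add_le _ _)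
      refine le_trans (eventWeight_mono ?_) (eventWeight_union_le g α _ _ n)
      intro ω hω
      by_cases hsh : ω ∈ S.shell u ρ n
      · exact Or.inl ⟨hsh, hω⟩
      · exact Or.inr hsh
    -- Strictness of the line prevents the complement of the shell from carrying the rate of `Z`.
    have h3 := (le_sup_iff.1 (h.trans h2)).resolve_right
      (not_le.2 (expGrowthSup_compl_shell_lt hs hg hu hα hstrict hρ))
    have h4 : (expGrowthInf fun n => S.μ n (S.shell u ρ n ∩ S.m n ⁻¹' U)) ≤
        expGrowthInf fun n => S.μ n (S.shell u r n ∩ S.m n ⁻¹' U) :=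
      expGrowthInf_monotone fun n => measure_mono
        (Set.inter_subset_inter_left _ (S.shell_mono (min_le_left r δ) n))
    have h5 := h3.trans (h1.trans (add_le_add_left h4 _))
    have h6 := add_le_add_left h5 ((α * u + g u : ℝ) : EReal)
    rw [← EReal.coe_add, add_assoc, ← EReal.coe_add] at h6
    convert h6 using 2
    · ring
    · congr 1; ring

/-! ### Common equilibria and nonequivalence of ensembles -/

theorem energy_eq_of_mem_microEquilibrium [TopologicalSpace X] {s : ℝ → EReal}
    (hs : S.IsMicrocanonicalEntropy s) {u σ : ℝ} (hu : s u = σ) {e : X → ℝ} (he : Continuous e)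
    (hrep : ∀ ε : ℝ, 0 < ε → ∀ᶠ n in atTop, ∀ ω : S.Ω n, |S.h n ω - e (S.m n ω)| ≤ ε)
    {x : X} (hx : x ∈ S.microEquilibrium u) : e x = u := by
  by_contra hne
  -- One third each for the shell width, the ball about `e x` and the error of the energy
  -- representation; the events are then eventually empty, with rate `⊥`.
  set δ := |e x - u| / 3 with hδ
  have hpos : 0 < δ := by have := abs_pos.2 (sub_ne_zero.2 hne); positivity
  have h1 := (mem_microEquilibrium_iff hs hu).1 hx (e ⁻¹' Metric.ball (e x) δ)
    (Metric.isOpen_ball.preimage he) (Metric.mem_ball_self hpos) δ hpos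
  have h2 : (fun n => S.μ n (S.shell u δ n ∩ S.m n ⁻¹' (e ⁻¹' Metric.ball (e x) δ)))
      =ᶠ[atTop] 0 := by
    filter_upwards [hrep δ hpos] with n hn
    rw [Pi.zero_apply]
    convert measure_empty (μ := S.μ n)
    refine Set.eq_empty_of_forall_notMem fun ω hω => ?_
    have a1 : |S.h n ω - u| ≤ δ := hω.1
    have a2 : |e (S.m n ω) - e x| < δ := hω.2
    have a3 := hn ω
    have a4 : |e x - u| ≤ |e (S.m n ω) - e x| + |S.h n ω - e (S.m n ω)| + |S.h n ω - u| := by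
      have t1 := abs_sub_le (e x) (e (S.m n ω)) u
      have t2 := abs_sub_le (e (S.m n ω)) (S.h n ω) u
      rw [abs_sub_comm (e x) (e (S.m n ω))] at t1
      rw [abs_sub_comm (e (S.m n ω)) (S.h n ω)] at t2
      linarith
    linarith
  rw [expGrowthInf_congr h2, expGrowthInf_zero, le_bot_iff] at h1
  exact EReal.coe_ne_bot _ h1

/-- A common equilibrium macrostate forces a supporting line. -/
theorem isSupportingSlope_of_mem_inter [TopologicalSpace X] [BorelSpace X]
    {s : ℝ → EReal} (hs : S.IsMicrocanonicalEntropy s) (hrep : S.HasEnergyRepresentation)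
    {g : ℝ → ℝ} (hg : Continuous g) {u σ α : ℝ} (hu : s u = σ) {x : X}
    (hx : x ∈ S.microEquilibrium u) (hx' : x ∈ S.canonEquilibrium g α) :
    IsSupportingSlope (modifiedEntropy s g) u α := by
  obtain ⟨e, he, hrep⟩ := hrep
  have hxu := energy_eq_of_mem_microEquilibrium hs hu he hrep hx
  intro v
  rw [modifiedEntropy_le_iff hu]
  refine (hs.le_expGrowthInf_partitionFunction hg α v).trans
    (expGrowthInf_le_expGrowthSup.trans (EReal.le_of_forall_pos_le_add_coe fun ε hε => ?_))
  obtain ⟨δ, hδ, hW⟩ := exists_shell_growth hg S α u (half_pos hε)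
  have hlt : s u < ((σ + ε / 2 : ℝ) : EReal) := by
    rw [hu, EReal.coe_lt_coe_iff]; linarith
  obtain ⟨r, hr, hrδ, hr2⟩ := hs.exists_expGrowthSup_shell_lt hlt hδ
  -- The other `r / 2` absorbs the error of the energy representation.
  set U := e ⁻¹' Metric.ball u (r / 2) with hUdef
  have hU : IsOpen U := Metric.isOpen_ball.preimage he
  have hxU : x ∈ U := by
    rw [hUdef, Set.mem_preimage, hxu]; exact Metric.mem_ball_self (half_pos hr)
  have hmeas : ∀ n, MeasurableSet (S.m n ⁻¹' U) := fun n => S.measurable_m n hU.measurableSet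
  have hsub : ∀ᶠ n in atTop, S.m n ⁻¹' U ⊆ S.shell u r n := by
    filter_upwards [hrep (r / 2) (half_pos hr)] with n hn ω hω
    have a1 : |e (S.m n ω) - u| < r / 2 := hω
    have a2 := hn ω
    have a3 := abs_sub_le (S.h n ω) (e (S.m n ω)) u
    change |S.h n ω - u| ≤ r
    linarith
  have hWU : expGrowthSup (S.eventWeight g α fun n => S.m n ⁻¹' U) ≤
      ((σ - (α * u + g u) + ε : ℝ) : EReal) := by
    refine (expGrowthSup_eventually_monotone (hsub.mono fun n hn =>
      eventWeight_mono (B := S.shell u r) hn)).trans ?_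
    refine (hW _ (S.measurableSet_shell u r) fun n => S.shell_mono hrδ n).1.trans ?_
    refine (add_le_add_left hr2.le _).trans ?_
    rw [← EReal.coe_add, EReal.coe_le_coe_iff]
    linarith
  have hZ : expGrowthSup (S.partitionFunction g α) ≠ ⊥ := by
    have h1 := (hs.le_expGrowthInf_partitionFunction hg α u).trans expGrowthInf_le_expGrowthSup
    rw [hu, ← EReal.coe_add] at h1
    exact ((EReal.bot_lt_coe _).trans_le h1).ne'
  have h0 := hx' U hU hxU
  have eq : (fun n => S.generalizedCanonical g α n (S.m n ⁻¹' U)) =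
      (S.partitionFunction g α)⁻¹ * S.eventWeight g α fun n => S.m n ⁻¹' U :=
    funext fun n => generalizedCanonical_apply g α hmeas n
  rw [eq] at h0
  -- This inequality also excludes an infinite rate of `Z`, which would make the right side `⊥`; so
  -- `α` need not be admissible.
  have h1 : (0 : EReal) ≤ -expGrowthSup (S.partitionFunction g α) +
      expGrowthSup (S.eventWeight g α fun n => S.m n ⁻¹' U) := by
    rw [← h0, ← expGrowthInf_inv]
    refine expGrowthInf_mul_le' (Or.inr (hWU.trans_lt (EReal.coe_lt_top _)).ne) (Or.inl ?_)
    rw [expGrowthInf_inv]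
    simpa using hZ
  have h2 := h1.trans (add_le_add_right hWU _)
  rw [← EReal.coe_add]
  generalize expGrowthSup (S.partitionFunction g α) = z at h2 hZ ⊢
  induction z with
  | bot => exact bot_le
  | top => simp at h2
  | coe z =>
    norm_cast at h2 ⊢
    linarith

end ManyBodySystem

theorem theorem6 {X : Type*} [TopologicalSpace X] [MeasurableSpace X] [BorelSpace X]
    (S : ManyBodySystem X) (s : ℝ → EReal) (hs : S.IsMicrocanonicalEntropy s)
    (hrep : S.HasEnergyRepresentation)
    (g : ℝ → ℝ) (hg : Continuous g)
    (u : ℝ) (hbot : s u ≠ ⊥) (htop : s u ≠ ⊤) :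
    ((∃ α ∈ S.admissibleParams g, IsStrictSupportingSlope (modifiedEntropy s g) u α) →
      ∃ α ∈ S.admissibleParams g, IsStrictSupportingSlope (modifiedEntropy s g) u α ∧
        S.microEquilibrium u = S.canonEquilibrium g α ∧
        ∀ d : ℝ, HasFiniteDerivAt (modifiedEntropy s g) d u → α = d) ∧
    ((¬ ∃ α : ℝ, IsSupportingSlope (modifiedEntropy s g) u α) →
      ∀ α : ℝ, S.microEquilibrium u ∩ S.canonEquilibrium g α = ∅) ∧
    (modifiedEntropy s g u ≠ lfTransform (lfTransform (modifiedEntropy s g)) u →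
      ∀ α : ℝ, S.microEquilibrium u ∩ S.canonEquilibrium g α = ∅) ∧
    (u ∈ intrinsicInterior ℝ (convexHull ℝ {v : ℝ | s v ≠ ⊥}) →
      ((¬ ∃ α : ℝ, IsSupportingSlope (modifiedEntropy s g) u α) ↔
        modifiedEntropy s g u ≠ lfTransform (lfTransform (modifiedEntropy s g)) u)) := by
  obtain ⟨σ, hu⟩ : ∃ σ : ℝ, s u = σ := ⟨_, (EReal.coe_toReal htop hbot).symm⟩
  have hgu : modifiedEntropy s g u = ((σ - g u : ℝ) : EReal) := by
    rw [modifiedEntropy, hu, EReal.coe_sub]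
  have hdisj : (¬ ∃ α : ℝ, IsSupportingSlope (modifiedEntropy s g) u α) →
      ∀ α : ℝ, S.microEquilibrium u ∩ S.canonEquilibrium g α = ∅ := fun h α =>
    Set.eq_empty_of_forall_notMem fun x hx =>
      h ⟨α, ManyBodySystem.isSupportingSlope_of_mem_inter hs hrep hg hu hx.1 hx.2⟩
  have hno : modifiedEntropy s g u ≠ lfTransform (lfTransform (modifiedEntropy s g)) u →
      ¬ ∃ α : ℝ, IsSupportingSlope (modifiedEntropy s g) u α := fun hne ⟨α, hα⟩ =>
    hne (lfTransform_lfTransform_eq_of_isSupportingSlope hgu hα).symm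
  refine ⟨?_, hdisj, fun hne => hdisj (hno hne), fun hint => ⟨fun h heq => h ?_, hno⟩⟩
  · rintro ⟨α, hα, hstrict⟩
    exact ⟨α, hα, hstrict,
      ManyBodySystem.microEquilibrium_eq_canonEquilibrium hs hg hu hα hstrict,
      fun d hd => hstrict.isSupportingSlope.eq_of_hasFiniteDerivAt hd⟩
  · refine exists_isSupportingSlope hgu ?_ heq
    have hset : {v : ℝ | modifiedEntropy s g v ≠ ⊥} = {v : ℝ | s v ≠ ⊥} := by
      ext v
      change modifiedEntropy s g v ≠ ⊥ ↔ s v ≠ ⊥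
      rw [modifiedEntropy]
      induction s v with
      | bot => simp
      | top => simp
      | coe y =>
        exact iff_of_true (by rw [← EReal.coe_sub]; exact EReal.coe_ne_bot _) (EReal.coe_ne_bot _)
    rw [hset]
    exact hint
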